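/- All tournaments are finite. The chromatic number $\chi(G)$ of a tournament $G$ is the minimum $k$ such that $V(G)$ is the union of $k$ sets each inducing an acyclic subtournament; for $A\subseteq V(G)$, $\chi(A)$ is the chromatic number of the subtournament $G[A]$ induced on $A$. For disjoint $A,B\subseteq V(G)$ write $A\Rightarrow B$ if no edge has tail in $B$ and head in $A$. A diamond in $G$ is a quadruple $(a,b,P,Q)$, where $a,b\in V(G)$ are distinct and $P,Q$ are disjoint subsets of $V(G)\setminus\{a,b\}$ with $\{a\}\Rightarrow P\Rightarrow \{b\}\Rightarrow Q\Rightarrow \{a\}$; its chromatic number is $\min(\chi(P),\chi(Q))$. Let $\mathcal{S}_1$ be the one-vertex tournament and, for $t\ge 2$, let $\mathcal{S}_t$ be the tournament whose vertex set is the disjoint union of $A_1,A_2,\{v\}$, where $A_1,A_2$ each induce a copy of $\mathcal{S}_{t-1}$ and $A_1\Rightarrow A_2\Rightarrow\{v\}\Rightarrow A_1$. A tournament is $\mathcal{S}_t$-free if no subtournament of it is isomorphic to $\mathcal{S}_t$. Let $t\ge 2$ be an integer, and let $c_2=1$. Then $$\forall d_2\,\exists c_3\,\forall d_3\,\exists c_4\cdots\forall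 d_{t-1}\,\exists c_t$$ (where $d_2,c_3,d_3,\ldots,c_t$ are all non-negative integers; for $t=2$ there are no quantifiers) such that the following holds. For every $\mathcal{S}_t$-free tournament $G$, either every diamond in $G$ has chromatic number less than $c_t$, or for some $i\in\{2,\ldots,t-1\}$ there is a subtournament $G'$ of $G$ with $\chi(G')\ge d_i$ such that every diamond of $G'$ has chromatic number less than $c_i$. -/

import Mathlib

universe u

/-- A tournament with vertex set `V`: a loopless digraph such that for any two distinct vertices
exactly one of the two possible edges between them is present.
`G.Adj a b` says that `a` is adjacent to `b`, that is, the edge has tail `a` and head `b`. -/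
structure Tournament (V : Type*) extends Digraph V where
  irrefl : ∀ a, ¬ Adj a a
  exactlyOne : ∀ a b, a ≠ b → Xor (Adj a b) (Adj b a)

namespace Tournament

/-- The subtournament `G[A]` with vertex set `A`. -/
def induce {V : Type*} (G : Tournament V) (A : Set V) : Tournament A where
  Adj x y := G.Adj x y
  irrefl x := G.irrefl x
  exactlyOne x y h := G.exactlyOne x y (fun e => h (Subtype.ext e))

/-- There is no directed cycle. -/
def IsAcyclic {V : Type*} (G : Tournament V) : Prop :=
  ∀ v, ¬ Relation.TransGen G.Adj v v

/-- The minimum `k` such that the vertex set is the union of `k` subsets, each inducing an acyclic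
subtournament (such `k` exist when `V` is finite). -/
noncomputable def chromaticNumber {V : Type*} (G : Tournament V) : ℕ :=
  sInf {k : ℕ | ∃ A : Fin k → Set V,
    (⋃ i, A i) = Set.univ ∧ ∀ i, (G.induce (A i)).IsAcyclic}

/-- `A ⇒ B`: the sets are disjoint and no edge has tail in `B` and head in `A`. -/
def CompleteTo {V : Type*} (G : Tournament V) (A B : Set V) : Prop :=
  Disjoint A B ∧ ∀ x ∈ A, ∀ y ∈ B, ¬ G.Adj y x

/-- Diamonds `(a, b, P, Q)` of `G`. -/
structure Diamond {V : Type*} (G : Tournament V) where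
  a : V
  b : V
  P : Set V
  Q : Set V
  a_ne_b : a ≠ b
  P_subset : P ⊆ Set.univ \ {a, b}
  Q_subset : Q ⊆ Set.univ \ {a, b}
  disjoint : Disjoint P Q
  a_to_P : G.CompleteTo {a} P
  P_to_b : G.CompleteTo P {b}
  b_to_Q : G.CompleteTo {b} Q
  Q_to_a : G.CompleteTo Q {a}

/-- The chromatic number of a diamond `(a, b, P, Q)` is the minimum of `χ(G[P])` and `χ(G[Q])`. -/
noncomputable def Diamond.chromaticNumber {V : Type*} {G : Tournament V} (D : G.Diamond) : ℕ :=
  min (G.induce D.P).chromaticNumber (G.induce D.Q).chromaticNumber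

/-- `G` contains `H` if some subtournament of `G` is isomorphic to `H`. -/
def Contains {V W : Type*} (G : Tournament V) (H : Tournament W) : Prop :=
  ∃ A : Set V, Nonempty ((G.induce A).Adj ≃r H.Adj)

/-- `G` is `H`-free if no subtournament of `G` is isomorphic to `H`. -/
def IsFree {V W : Type*} (G : Tournament V) (H : Tournament W) : Prop :=
  ¬ G.Contains H

/-- The edges of `Δ(H₁, H₂, H₃)`: those of the three tournaments, and all edges from the first
part to the second, from the second to the third and from the third to the first. -/
def deltaAdj {V₁ V₂ V₃ : Type*} (H₁ : Tournament V₁) (H₂ : Tournament V₂) (H₃ : Tournament V₃) :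
    V₁ ⊕ V₂ ⊕ V₃ → V₁ ⊕ V₂ ⊕ V₃ → Prop
  | .inl x, .inl y => H₁.Adj x y
  | .inr (.inl x), .inr (.inl y) => H₂.Adj x y
  | .inr (.inr x), .inr (.inr y) => H₃.Adj x y
  | .inl _, .inr (.inl _) => True
  | .inr (.inl _), .inr (.inr _) => True
  | .inr (.inr _), .inl _ => True
  | .inr (.inl _), .inl _ => False
  | .inr (.inr _), .inr (.inl _) => False
  | .inl _, .inr (.inr _) => False

/-- The tournament `Δ(H₁, H₂, H₃)`. -/
def delta {V₁ V₂ V₃ : Type*} (H₁ : Tournament V₁) (H₂ : Tournament V₂) (H₃ : Tournament V₃) :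
    Tournament (V₁ ⊕ V₂ ⊕ V₃) where
  Adj := deltaAdj H₁ H₂ H₃
  irrefl := by
    rintro (x | x | x)
    · exact H₁.irrefl x
    · exact H₂.irrefl x
    · exact H₃.irrefl x
  exactlyOne := by
    rintro (x | x | x) (y | y | y) h
    · exact H₁.exactlyOne x y (fun e => h (by rw [e]))
    · exact Or.inl ⟨trivial, id⟩
    · exact Or.inr ⟨trivial, id⟩
    · exact Or.inr ⟨trivial, id⟩
    · exact H₂.exactlyOne x y (fun e => h (by rw [e]))
    · exact Or.inl ⟨trivial, id⟩
    · exact Or.inl ⟨trivial, id⟩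
    · exact Or.inr ⟨trivial, id⟩
    · exact H₃.exactlyOne x y (fun e => h (by rw [e]))

/-- The tournament with one vertex. -/
def single : Tournament Unit where
  Adj _ _ := False
  irrefl _ := id
  exactlyOne _ _ h := absurd rfl h

/-- The vertex set of `𝒮ₜ` (the value at `t = 0` is a dummy). -/
def SVertex : ℕ → Type
  | 0 => Unit
  | 1 => Unit
  | t + 2 => SVertex (t + 1) ⊕ SVertex (t + 1) ⊕ Unit

/-- The tournaments `𝒮ₜ`: `𝒮₁` has one vertex, and `𝒮ₜ = Δ(𝒮ₜ₋₁, 𝒮ₜ₋₁, 1)` for `t ≥ 2`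
(the value at `t = 0` is a dummy). -/
def S : (t : ℕ) → Tournament (SVertex t)
  | 0 => single
  | 1 => single
  | t + 2 => delta (S (t + 1)) (S (t + 1)) single

end Tournament

/-- `AlternatingQuantifiers c₂ n P` is the assertion
`∀ d₂ ∃ c₃ ∀ d₃ ∃ c₄ ⋯ ∀ dₙ₊₁ ∃ cₙ₊₂, P c d`, all variables ranging over `ℕ`, about the sequences
`c` and `d` with the given entries `c₂, c₃, …, cₙ₊₂` and `d₂, …, dₙ₊₁` (their other
entries are `0`). The recursion adds the innermost pair of quantifiers. -/
def AlternatingQuantifiers (c₂ : ℕ) : ℕ → ((ℕ → ℕ) → (ℕ → ℕ) → Prop) → Prop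
  | 0, P => P (Function.update 0 2 c₂) 0
  | n + 1, P => AlternatingQuantifiers c₂ n fun c d =>
      ∀ x : ℕ, ∃ y : ℕ, P (Function.update c (n + 3) y) (Function.update d (n + 2) x)

namespace Tournament

/-! The proof is by induction on `t`. Write `H` for `𝒮ₜ₋₁`, so that `𝒮ₜ = Δ(H, H, 1)`. If every set
of chromatic number at least `d` contains `H`, then an `𝒮ₜ`-free `G` has no diamond of large
chromatic number (`exists_diamond_bound`). Otherwise some `X` with `χ(X) ≥ d = dₜ₋₁` is `H`-free,
and the inductive statement applies to `G[X]`.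

For the bound, take a large diamond `(a, b, P, Q)`. No copy of `H` in `P` is complete to or from one
in `Q`, since `a` or `b` would complete `𝒮ₜ`. Together with `𝒮ₜ`-freeness this forces `P` to be
mixing (`chi_lt_of_almost_complete`). A mixing set of large chromatic number contains every small
tournament by greedy embedding (`exists_hom_of_isMixing`), in particular `𝒮ₜ`, a contradiction. -/

variable {V W : Type*}

/-! ### Tournaments and chromatic number of vertex sets. -/

lemma adj_of_not_adj (G : Tournament V) {x y : V} (hne : x ≠ y) (h : ¬ G.Adj x y) :
    G.Adj y x :=
  ((G.exactlyOne x y hne).resolve_left fun h' => h h'.1).1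

lemma not_adj_of_adj (G : Tournament V) {x y : V} (h : G.Adj x y) : ¬ G.Adj y x := by
  have hne : x ≠ y := fun e => G.irrefl x (by rw [← e] at h; exact h)
  rcases G.exactlyOne x y hne with h' | h'
  · exact h'.2
  · exact absurd h h'.2

lemma IsAcyclic.of_hom {G : Tournament V} {H : Tournament W} (hG : G.IsAcyclic) (f : W → V)
    (hf : ∀ x y, H.Adj x y → G.Adj (f x) (f y)) : H.IsAcyclic :=
  fun v hv => hG (f v) (hv.lift f hf)

lemma isAcyclic_induce_of_subsingleton (G : Tournament V) {A : Set V} (hA : A.Subsingleton) :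
    (G.induce A).IsAcyclic := by
  have hno : ∀ x y : A, ¬ (G.induce A).Adj x y := fun x y h => by
    have e : x = y := Subtype.ext (hA x.2 y.2)
    rw [e] at h
    exact (G.induce A).irrefl y h
  intro v hv
  cases hv with
  | single h => exact hno _ _ h
  | tail _ h => exact hno _ _ h

/-- The chromatic number of the subtournament induced on `X`. -/
noncomputable def chi (G : Tournament V) (X : Set V) : ℕ := (G.induce X).chromaticNumber

lemma chi_le_of_cover (G : Tournament V) {X : Set V} {ι : Type*} [Fintype ι] (A : ι → Set V)
    (hX : X ⊆ ⋃ i, A i) (hA : ∀ i, (G.induce (A i)).IsAcyclic) :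
    G.chi X ≤ Fintype.card ι := by
  refine Nat.sInf_le
    ⟨fun k => Subtype.val ⁻¹' A ((Fintype.equivFin ι).symm k), ?_, fun k => ?_⟩
  · refine Set.eq_univ_of_forall fun x => ?_
    obtain ⟨i, hi⟩ := Set.mem_iUnion.1 (hX x.2)
    exact Set.mem_iUnion.2 ⟨Fintype.equivFin ι i, by simpa using hi⟩
  · exact (hA _).of_hom (fun x => ⟨x.1.1, x.2⟩) fun _ _ h => h

lemma chi_singleton_le (G : Tournament V) (x : V) : G.chi {x} ≤ 1 := by
  simpa using G.chi_le_of_cover (ι := Unit) (fun _ => {x})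
    (fun y hy => Set.mem_iUnion.2 ⟨(), hy⟩)
    fun _ => G.isAcyclic_induce_of_subsingleton Set.subsingleton_singleton

lemma chi_empty (G : Tournament V) : G.chi ∅ = 0 := by
  simpa using G.chi_le_of_cover (X := ∅) (ι := Empty) (fun _ => ∅) (Set.empty_subset _)
    fun i => i.elim

lemma nonempty_of_chi_pos (G : Tournament V) {X : Set V} (h : 0 < G.chi X) : X.Nonempty := by
  rw [Set.nonempty_iff_ne_empty]
  rintro rfl
  rw [chi_empty] at h
  exact lt_irrefl _ h

lemma exists_cover (G : Tournament V) [Finite V] (X : Set V) :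
    ∃ A : Fin (G.chi X) → Set V, X ⊆ ⋃ i, A i ∧ ∀ i, (G.induce (A i)).IsAcyclic := by
  have hne : {k : ℕ | ∃ A : Fin k → Set X,
      (⋃ i, A i) = Set.univ ∧ ∀ i, ((G.induce X).induce (A i)).IsAcyclic}.Nonempty := by
    refine ⟨Nat.card X, fun i => {(Finite.equivFin X).symm i}, ?_, fun i => ?_⟩
    · refine Set.eq_univ_of_forall fun x => Set.mem_iUnion.2 ⟨Finite.equivFin X x, ?_⟩
      exact ((Finite.equivFin X).symm_apply_apply x).symm
    · exact isAcyclic_induce_of_subsingleton _ Set.subsingleton_singleton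
  obtain ⟨A, hA, hA'⟩ := Nat.sInf_mem hne
  refine ⟨fun i => Subtype.val '' A i, fun x hx => ?_, fun i => ?_⟩
  · have : (⟨x, hx⟩ : X) ∈ ⋃ i, A i := by rw [hA]; trivial
    obtain ⟨i, hi⟩ := Set.mem_iUnion.1 this
    exact Set.mem_iUnion.2 ⟨i, ⟨x, hx⟩, hi, rfl⟩
  · have hx : ∀ x : Subtype.val '' A i, ∃ y, y ∈ A i ∧ y.1 = x.1 := fun x => x.2
    choose g hg hgx using hx
    refine (hA' i).of_hom (fun x => ⟨g x, hg x⟩) fun x y h => ?_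
    change G.Adj (g x).1 (g y).1
    rw [hgx, hgx]
    exact h

section Chi

variable (G : Tournament V) [Finite V]

lemma chi_mono {X Y : Set V} (h : X ⊆ Y) : G.chi X ≤ G.chi Y := by
  obtain ⟨A, hA, hA'⟩ := G.exists_cover Y
  simpa using G.chi_le_of_cover A (h.trans hA) hA'

lemma chi_union_le (X Y : Set V) : G.chi (X ∪ Y) ≤ G.chi X + G.chi Y := by
  obtain ⟨A, hA, hA'⟩ := G.exists_cover X
  obtain ⟨B, hB, hB'⟩ := G.exists_cover Y
  have := G.chi_le_of_cover (X := X ∪ Y) (Sum.elim A B) ?_ ?_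
  · simpa using this
  · rintro x (hx | hx)
    · obtain ⟨i, hi⟩ := Set.mem_iUnion.1 (hA hx)
      exact Set.mem_iUnion.2 ⟨.inl i, hi⟩
    · obtain ⟨i, hi⟩ := Set.mem_iUnion.1 (hB hx)
      exact Set.mem_iUnion.2 ⟨.inr i, hi⟩
  · rintro (i | i)
    · exact hA' i
    · exact hB' i

lemma chi_biUnion_le {ι : Type*} (s : Finset ι) (A : ι → Set V) {m : ℕ}
    (hA : ∀ i ∈ s, G.chi (A i) ≤ m) : G.chi (⋃ i ∈ s, A i) ≤ s.card * m := by
  classical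
  induction s using Finset.induction_on with
  | empty => simp [chi_empty]
  | insert i s hi ih =>
    rw [Finset.set_biUnion_insert, Finset.card_insert_of_notMem hi]
    have h₁ := hA i (Finset.mem_insert_self i s)
    have h₂ := ih fun j hj => hA j (Finset.mem_insert_of_mem hj)
    have h₃ := G.chi_union_le (A i) (⋃ j ∈ s, A j)
    linarith

/-- `X` contains a member of the family `C`, avoiding the neighbourhoods of few vertices. -/
lemma exists_copy_avoiding [Fintype W] {C : (W → V) → Prop} {d m : ℕ}
    (hd : ∀ X : Set V, d ≤ G.chi X → ∃ f, C f ∧ ∀ i, f i ∈ X)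
    {X : Set V} (g : W → V) (bad : V → V → Prop)
    (hbad : ∀ i, G.chi (X ∩ {x | bad x (g i)}) ≤ m) (hX : Fintype.card W * m + d ≤ G.chi X) :
    ∃ f, C f ∧ (∀ i, f i ∈ X) ∧ ∀ i j, ¬ bad (f i) (g j) := by
  set U : Set V := ⋃ i ∈ (Finset.univ : Finset W), X ∩ {x | bad x (g i)} with hU
  have hUle : G.chi U ≤ Fintype.card W * m := G.chi_biUnion_le Finset.univ _ fun i _ => hbad i
  have h₁ : G.chi X ≤ G.chi U + G.chi (X \ U) :=
    (G.chi_mono (by rw [Set.union_sdiff_self]; exact Set.subset_union_right)).trans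
      (G.chi_union_le U (X \ U))
  obtain ⟨f, hf, hfX⟩ := hd (X \ U) (by linarith)
  refine ⟨f, hf, fun i => (hfX i).1, fun i j h => (hfX i).2 ?_⟩
  exact Set.mem_biUnion (Finset.mem_coe.2 (Finset.mem_univ j)) ⟨(hfX i).1, h⟩

/-- If `X` is almost complete to `Y` with respect to the orientation `R`, and there is a third set
`Q` with no complete pair of copies between it and `X ∪ Y`, then `Y` has bounded chromatic
number. -/
lemma chi_lt_of_almost_complete [Fintype W] {C : (W → V) → Prop} {d s : ℕ}
    (hd : ∀ X : Set V, d ≤ G.chi X → ∃ f, C f ∧ ∀ i, f i ∈ X)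
    (R : V → V → Prop) (hR : ∀ x y, x ≠ y → ¬ R x y → R y x)
    (hfree : ∀ f g, C f → C g → ∀ v,
      ¬ ((∀ i j, R (f i) (g j)) ∧ (∀ j, R (g j) v) ∧ ∀ i, R v (f i)))
    {P Q : Set V} (hPQ : Disjoint P Q)
    (hcross : ∀ f g, C f → C g → (∀ i, f i ∈ P) → (∀ i, g i ∈ Q) →
      (¬ ∀ i j, R (f i) (g j)) ∧ ¬ ∀ i j, R (g j) (f i))
    (hQ : d + d ≤ G.chi Q) {X Y : Set V} (hXP : X ⊆ P) (hYP : Y ⊆ P)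
    (hX : Fintype.card W * (Fintype.card W * (s + 1) + d) + d ≤ G.chi X)
    (hXY : ∀ y ∈ Y, G.chi (X ∩ {x | R y x}) ≤ s) :
    G.chi Y < Fintype.card W * d + d := by
  by_contra! hY
  have hne : ∀ {p q}, p ∈ P → q ∈ Q → p ≠ q := fun hp hq e =>
    Set.disjoint_left.1 hPQ hp (e ▸ hq)
  -- Reading `R` as the arrow, `Q₁` consists of the vertices of `Q` with few in-neighbours in `Y`.
  -- If `Q₁` is large, a copy in it dominates a copy in `Y`.
  set Q₁ : Set V := {q ∈ Q | G.chi (Y ∩ {y | R y q}) ≤ d} with hQ₁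
  have hsplit : G.chi Q ≤ G.chi Q₁ + G.chi (Q \ Q₁) :=
    (G.chi_mono (by rw [Set.union_sdiff_self]; exact Set.subset_union_right)).trans
      (G.chi_union_le Q₁ (Q \ Q₁))
  rcases le_or_gt d (G.chi Q₁) with h | h
  · obtain ⟨g, hg, hgQ⟩ := hd Q₁ h
    obtain ⟨f, hf, hfY, hfg⟩ :=
      G.exists_copy_avoiding hd g R (fun i => (hgQ i).2) hY
    exact (hcross f g hf hg (fun i => hYP (hfY i)) fun i => (hgQ i).1).2
      fun i j => hR _ _ (hne (hYP (hfY i)) (hgQ j).1) (hfg i j)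
  · obtain ⟨g, hg, hgQ⟩ := hd (Q \ Q₁) (by linarith)
    -- If `q` had many out-neighbours in `X`, a copy `b` among its in-neighbours in `Y` and a copy
    -- `a` among those out-neighbours would satisfy `a ⇒ b ⇒ q ⇒ a`.
    have hsmall : ∀ q ∈ Q \ Q₁,
        G.chi (X ∩ {x | R q x}) ≤ Fintype.card W * (s + 1) + d := by
      rintro q ⟨hq, hq'⟩
      by_contra! hlt
      have hdq : d ≤ G.chi (Y ∩ {y | R y q}) := by
        by_contra! hlt'
        exact hq' ⟨hq, hlt'.le⟩
      obtain ⟨b, hb, hbY⟩ := hd _ hdq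
      -- `X` and `Y` may overlap, so the vertices `b i` are removed as well; hence `s + 1`.
      have hbX : ∀ i, G.chi ((X ∩ {x | R q x}) ∩ {x | R (b i) x ∨ x = b i}) ≤ s + 1 := by
        intro i
        have h₁ : (X ∩ {x | R q x}) ∩ {x | R (b i) x ∨ x = b i} ⊆
            (X ∩ {x | R (b i) x}) ∪ {b i} := by
          rintro x ⟨⟨hx, -⟩, hx' | hx'⟩
          · exact Or.inl ⟨hx, hx'⟩
          · exact Or.inr hx'
        have h₂ := G.chi_mono h₁
        have h₃ := G.chi_union_le (X ∩ {x | R (b i) x}) {b i}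
        have h₄ := hXY (b i) (hbY i).1
        have h₅ := G.chi_singleton_le (b i)
        linarith
      obtain ⟨a, ha, haX, hab⟩ := G.exists_copy_avoiding hd b
        (fun x y => R y x ∨ x = y) hbX hlt.le
      refine hfree a b ha hb q ⟨fun i j => ?_, fun j => (hbY j).2, fun i => (haX i).2⟩
      have := not_or.1 (hab i j)
      exact hR _ _ (Ne.symm this.2) this.1
    obtain ⟨f, hf, hfX, hfg⟩ := G.exists_copy_avoiding hd g (fun x q => R q x)
      (fun i => hsmall _ (hgQ i)) hX
    exact (hcross f g hf hg (fun i => hXP (hfX i)) fun i => (hgQ i).1).1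
      fun i j => hR _ _ (hne (hXP (hfX i)) (hgQ j).1).symm (hfg i j)

end Chi

/-! ### Mixing sets and greedy embedding. -/

/-- Every set `X ⊆ P` of large chromatic number is cut by all vertices of `P`, up to a set of
chromatic number at most `k`, into two parts of large chromatic number. -/
def IsMixing (G : Tournament V) (P : Set V) (k : ℕ) (φ : ℕ → ℕ) : Prop :=
  ∀ s : ℕ, ∀ X ⊆ P, φ s ≤ G.chi X →
    G.chi {y ∈ P | G.chi (X ∩ {x | G.Adj y x}) ≤ s} ≤ k ∧
    G.chi {y ∈ P | G.chi (X ∩ {x | G.Adj x y}) ≤ s} ≤ k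

/-- Mixing sets of large chromatic number contain all small oriented graphs. -/
lemma exists_hom_of_isMixing (k : ℕ) (φ : ℕ → ℕ) (n : ℕ) :
    ∃ M : ℕ, ∀ (V : Type u) [Finite V] (G : Tournament V) (P : Set V), G.IsMixing P k φ →
      ∀ X : Fin n → Set V, (∀ i, X i ⊆ P) → (∀ i, M ≤ G.chi (X i)) →
      ∀ r : Fin n → Fin n → Prop, (∀ i j, r i j → ¬ r j i) →
      ∃ f : Fin n → V, (∀ i, f i ∈ X i) ∧ ∀ i j, r i j → G.Adj (f i) (f j) := by
  classical
  induction n with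
  | zero => exact ⟨0, fun V _ G P _ X _ _ r _ => ⟨Fin.elim0, fun i => i.elim0, fun i => i.elim0⟩⟩
  | succ n ih =>
    obtain ⟨M, hM⟩ := ih
    -- `φ M` makes mixing apply to every later set. The rest leaves a vertex of `X 0` outside the
    -- `n` bad sets, each of chromatic number at most `2k`.
    refine ⟨φ M + n * (k + k) + 1, fun V _ G P hP X hXP hX r hr => ?_⟩
    let bad : Fin n → Set V := fun j =>
      {y ∈ P | G.chi (X j.succ ∩ {x | G.Adj y x}) ≤ M} ∪
        {y ∈ P | G.chi (X j.succ ∩ {x | G.Adj x y}) ≤ M}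
    have hbad : ∀ j, G.chi (bad j) ≤ k + k := fun j => by
      have h := hP M (X j.succ) (hXP _) (by have := hX j.succ; omega)
      exact (G.chi_union_le _ _).trans (add_le_add h.1 h.2)
    have hU := G.chi_biUnion_le Finset.univ bad fun j _ => hbad j
    rw [Finset.card_univ, Fintype.card_fin] at hU
    obtain ⟨v, hv, hvU⟩ : ∃ v ∈ X 0, v ∉ ⋃ j ∈ (Finset.univ : Finset (Fin n)), bad j := by
      by_contra! hsub
      have h₁ := G.chi_mono (show X 0 ⊆ _ from hsub)
      have h₂ := hX 0
      omega
    have hvbad : ∀ j, v ∉ bad j := fun j hj =>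
      hvU (Set.mem_biUnion (Finset.mem_coe.2 (Finset.mem_univ j)) hj)
    -- Pairs unrelated by `r` carry no requirement, so in-neighbours of `v` serve for them too.
    let Y : Fin n → Set V := fun j =>
      if r 0 j.succ then X j.succ ∩ {x | G.Adj v x} else X j.succ ∩ {x | G.Adj x v}
    have hYX : ∀ j, Y j ⊆ X j.succ := fun j => by
      dsimp only [Y]
      split_ifs
      · exact Set.inter_subset_left
      · exact Set.inter_subset_left
    have hY : ∀ j, M ≤ G.chi (Y j) := fun j => by
      have h := hvbad j
      dsimp only [Y]
      split_ifs
      · by_contra! hlt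
        exact h (Or.inl ⟨hXP 0 hv, hlt.le⟩)
      · by_contra! hlt
        exact h (Or.inr ⟨hXP 0 hv, hlt.le⟩)
    obtain ⟨f, hfY, hf⟩ := hM V G P hP Y (fun j => (hYX j).trans (hXP _)) hY
      (fun i j => r i.succ j.succ) (fun i j => hr _ _)
    refine ⟨Fin.cons v f, fun i => ?_, fun i j hij => ?_⟩
    · cases i using Fin.cases with
      | zero => exact hv
      | succ i => exact hYX i (hfY i)
    · cases i using Fin.cases with
      | zero =>
        cases j using Fin.cases with
        | zero => exact absurd hij (hr _ _ hij)
        | succ j =>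
          have := hfY j
          simp only [Y, hij, if_true] at this
          exact this.2
      | succ i =>
        cases j using Fin.cases with
        | zero =>
          have := hfY i
          simp only [Y, hr _ _ hij, if_false] at this
          exact this.2
        | succ j => exact hf i j hij

/-! ### Copies of `Δ(H, H, 1)` and diamonds. -/

/-- Distinct vertices of a tournament are adjacent, so an edge-preserving map is injective and
reflects edges. -/
lemma contains_of_hom {G : Tournament V} {H : Tournament W} (f : W → V)
    (hf : ∀ x y, H.Adj x y → G.Adj (f x) (f y)) : G.Contains H := by
  have hinj : Function.Injective f := fun x y e => by
    by_contra hne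
    by_cases h : H.Adj x y
    · have := hf _ _ h
      rw [e] at this
      exact G.irrefl _ this
    · have := hf _ _ (H.adj_of_not_adj hne h)
      rw [e] at this
      exact G.irrefl _ this
  refine ⟨Set.range f, ⟨RelIso.symm ⟨Equiv.ofInjective f hinj, fun {x y} => ?_⟩⟩⟩
  refine ⟨fun h => ?_, hf x y⟩
  by_contra hxy
  have hne : x ≠ y := by
    rintro rfl
    exact G.irrefl _ h
  exact G.not_adj_of_adj (hf _ _ (H.adj_of_not_adj hne hxy)) h

lemma Contains.exists_hom {G : Tournament V} {H : Tournament W} {X : Set V}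
    (h : (G.induce X).Contains H) :
    ∃ f : W → V, (∀ x y, H.Adj x y → G.Adj (f x) (f y)) ∧ ∀ x, f x ∈ X := by
  obtain ⟨A, ⟨e⟩⟩ := h
  exact ⟨fun x => (e.symm x).1.1, fun x y hxy => e.symm.map_rel_iff.2 hxy,
    fun x => (e.symm x).1.2⟩

lemma contains_delta {G : Tournament V} {H : Tournament W} {f g : W → V} {v : V}
    (hf : ∀ x y, H.Adj x y → G.Adj (f x) (f y)) (hg : ∀ x y, H.Adj x y → G.Adj (g x) (g y))
    (hfg : ∀ x y, G.Adj (f x) (g y)) (hgv : ∀ y, G.Adj (g y) v) (hvf : ∀ x, G.Adj v (f x)) :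
    G.Contains (delta H H single) := by
  refine contains_of_hom (Sum.elim f (Sum.elim g fun _ => v)) ?_
  rintro (x | x | x) (y | y | y) h
  · exact hf x y h
  · exact hfg x y
  · exact h.elim
  · exact h.elim
  · exact hg x y h
  · exact hgv x
  · exact hvf y
  · exact h.elim
  · exact h.elim

lemma Diamond.adj {G : Tournament V} (D : G.Diamond) :
    (∀ p ∈ D.P, G.Adj D.a p ∧ G.Adj p D.b) ∧ ∀ q ∈ D.Q, G.Adj D.b q ∧ G.Adj q D.a := by
  have key : ∀ {A B : Set V}, G.CompleteTo A B → ∀ x ∈ A, ∀ y ∈ B, G.Adj x y :=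
    fun h x hx y hy => G.adj_of_not_adj
      (fun e => Set.disjoint_left.1 h.1 hx (e ▸ hy)) (h.2 x hx y hy)
  exact ⟨fun p hp => ⟨key D.a_to_P _ rfl _ hp, key D.P_to_b _ hp _ rfl⟩,
    fun q hq => ⟨key D.b_to_Q _ rfl _ hq, key D.Q_to_a _ hq _ rfl⟩⟩

instance finite_SVertex : (t : ℕ) → Finite (SVertex t)
  | 0 => inferInstanceAs (Finite Unit)
  | 1 => inferInstanceAs (Finite Unit)
  | t + 2 =>
    have := finite_SVertex (t + 1)
    inferInstanceAs (Finite (SVertex (t + 1) ⊕ SVertex (t + 1) ⊕ Unit))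

/-- If all sets of chromatic number at least `d` contain `H`, then the diamonds of a
`Δ(H, H, 1)`-free tournament have bounded chromatic number. -/
lemma exists_diamond_bound {W : Type} [Finite W] (H : Tournament W) (d : ℕ) :
    ∃ c : ℕ, ∀ (V : Type u) [Finite V] (G : Tournament V), G.IsFree (delta H H single) →
      (∀ X : Set V, d ≤ G.chi X → (G.induce X).Contains H) →
      ∀ D : G.Diamond, D.chromaticNumber < c := by
  have := Fintype.ofFinite W
  let e := Finite.equivFin (W ⊕ W ⊕ Unit)
  obtain ⟨M, hM⟩ := exists_hom_of_isMixing.{u} (Fintype.card W * d + d)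
    (fun s => Fintype.card W * (Fintype.card W * (s + 1) + d) + d) (Nat.card (W ⊕ W ⊕ Unit))
  -- `M` is for the embedding in `P`; `d + d` lets one half of any partition of `Q` contain `H`.
  refine ⟨M + (d + d), fun V _ G hfree hH D => ?_⟩
  by_contra! hD
  have hDP : M + (d + d) ≤ G.chi D.P := hD.trans (min_le_left _ _)
  have hDQ : M + (d + d) ≤ G.chi D.Q := hD.trans (min_le_right _ _)
  let C : (W → V) → Prop := fun f => ∀ x y, H.Adj x y → G.Adj (f x) (f y)
  have hd : ∀ X : Set V, d ≤ G.chi X → ∃ f, C f ∧ ∀ i, f i ∈ X := fun X hX =>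
    (hH X hX).exists_hom
  have hno : ∀ f g, C f → C g → ∀ v,
      ¬ ((∀ i j, G.Adj (f i) (g j)) ∧ (∀ j, G.Adj (g j) v) ∧ ∀ i, G.Adj v (f i)) :=
    fun f g hf hg v h => hfree (contains_delta hf hg h.1 h.2.1 h.2.2)
  have hcross : ∀ f g, C f → C g → (∀ i, f i ∈ D.P) → (∀ i, g i ∈ D.Q) →
      (¬ ∀ i j, G.Adj (f i) (g j)) ∧ ¬ ∀ i j, G.Adj (g j) (f i) := fun f g hf hg hfP hgQ =>
    ⟨fun h => hno f g hf hg D.a ⟨h, fun j => (D.adj.2 _ (hgQ j)).2,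
        fun i => (D.adj.1 _ (hfP i)).1⟩,
      fun h => hno g f hg hf D.b ⟨fun i j => h j i, fun j => (D.adj.1 _ (hfP j)).2,
        fun i => (D.adj.2 _ (hgQ i)).1⟩⟩
  have hmix : G.IsMixing D.P (Fintype.card W * d + d)
      (fun s => Fintype.card W * (Fintype.card W * (s + 1) + d) + d) := by
    intro s X hXP hX
    constructor
    · exact (G.chi_lt_of_almost_complete hd G.Adj (fun x y => G.adj_of_not_adj) hno D.disjoint
        hcross (by omega) hXP (Set.sep_subset _ _) hX fun y hy => hy.2).le
    -- Reversing all edges swaps the roles of the two copies in `Δ(H, H, 1)`. The copies themselves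
    -- are not reversed.
    · exact (G.chi_lt_of_almost_complete hd (fun x y => G.Adj y x)
        (fun x y h => G.adj_of_not_adj h.symm)
        (fun f g hf hg v h => hno g f hg hf v ⟨fun i j => h.1 j i, h.2.2, h.2.1⟩) D.disjoint
        (fun f g hf hg hfP hgQ => (hcross f g hf hg hfP hgQ).symm)
        (by omega) hXP (Set.sep_subset _ _) hX fun y hy => hy.2).le
  obtain ⟨f, -, hf⟩ := hM V G D.P hmix (fun _ => D.P) (fun _ => subset_rfl) (fun _ => by omega)
    (fun i j => (delta H H single).Adj (e.symm i) (e.symm j))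
    (fun i j => (delta H H single).not_adj_of_adj)
  exact hfree (contains_of_hom (fun x => f (e x)) fun x y h => hf _ _ (by simpa using h))

/-! ### Induction on `t`. -/

/-- The conclusion of the main theorem for `𝒮ₜ` and given sequences `c` and `d`. -/
def DiamondDichotomy (t : ℕ) (c d : ℕ → ℕ) : Prop :=
  ∀ (V : Type u) [Finite V] (G : Tournament V), G.IsFree (Tournament.S t) →
    (∀ D : G.Diamond, D.chromaticNumber < c t) ∨
    ∃ i : ℕ, 2 ≤ i ∧ i ≤ t - 1 ∧ ∃ X : Set V,
      d i ≤ (G.induce X).chromaticNumber ∧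
      ∀ D : (G.induce X).Diamond, D.chromaticNumber < c i

/-- The edge between some `p ∈ P` and `q ∈ Q` forms a cyclic triangle with `a` or `b`, depending on
its direction. -/
lemma diamondDichotomy_two {c d : ℕ → ℕ} (hc : c 2 = 1) : DiamondDichotomy.{u} 2 c d := by
  refine fun V _ G hfree => Or.inl fun D => ?_
  rw [hc]
  by_contra! hD
  obtain ⟨p, hp⟩ := G.nonempty_of_chi_pos (X := D.P) (hD.trans (min_le_left _ _))
  obtain ⟨q, hq⟩ := G.nonempty_of_chi_pos (X := D.Q) (hD.trans (min_le_right _ _))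
  have hconst : ∀ (v : V) (x y : SVertex 1), (S 1).Adj x y → G.Adj v v := fun v x y h => h.elim
  apply hfree
  by_cases h : G.Adj p q
  · exact contains_delta (H := S 1) (v := D.a) (hconst p) (hconst q) (fun _ _ => h)
      (fun _ => (D.adj.2 q hq).2) fun _ => (D.adj.1 p hp).1
  · have hne : p ≠ q := fun e => Set.disjoint_left.1 D.disjoint hp (e ▸ hq)
    exact contains_delta (H := S 1) (v := D.b) (hconst q) (hconst p)
      (fun _ _ => G.adj_of_not_adj hne h) (fun _ => (D.adj.1 p hp).2)
      fun _ => (D.adj.2 q hq).1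

lemma chi_le_of_hom {G : Tournament V} [Finite V] {H : Tournament W} (f : W → V)
    (hf : ∀ x y, H.Adj x y → G.Adj (f x) (f y)) {X : Set W} {Y : Set V}
    (hXY : ∀ x ∈ X, f x ∈ Y) : H.chi X ≤ G.chi Y := by
  obtain ⟨A, hA, hA'⟩ := G.exists_cover Y
  have := H.chi_le_of_cover (X := X) (fun i => f ⁻¹' A i) (fun x hx => ?_) fun i => ?_
  · simpa using this
  · simpa using hA (hXY x hx)
  · exact (hA' i).of_hom (fun x => ⟨f x.1, x.2⟩) fun x y h => hf _ _ h

lemma CompleteTo.image {G : Tournament V} {H : Tournament W} (e : V ≃ W)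
    (he : ∀ x y, H.Adj (e x) (e y) ↔ G.Adj x y) {A B : Set V} (h : G.CompleteTo A B) :
    H.CompleteTo (e '' A) (e '' B) := by
  refine ⟨(Set.disjoint_image_iff e.injective).2 h.1, ?_⟩
  rintro _ ⟨x, hx, rfl⟩ _ ⟨y, hy, rfl⟩ hxy
  exact h.2 x hx y hy ((he y x).1 hxy)

/-- The image of a diamond under an isomorphism. -/
def Diamond.map {G : Tournament V} {H : Tournament W} (e : V ≃ W)
    (he : ∀ x y, H.Adj (e x) (e y) ↔ G.Adj x y) (D : G.Diamond) : H.Diamond where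
  a := e D.a
  b := e D.b
  P := e '' D.P
  Q := e '' D.Q
  a_ne_b := e.injective.ne D.a_ne_b
  P_subset := by
    rintro _ ⟨x, hx, rfl⟩
    simpa using D.P_subset hx
  Q_subset := by
    rintro _ ⟨x, hx, rfl⟩
    simpa using D.Q_subset hx
  disjoint := (Set.disjoint_image_iff e.injective).2 D.disjoint
  a_to_P := by simpa using D.a_to_P.image e he
  P_to_b := by simpa using D.P_to_b.image e he
  b_to_Q := by simpa using D.b_to_Q.image e he
  Q_to_a := by simpa using D.Q_to_a.image e he

lemma Diamond.chromaticNumber_le_map {G : Tournament V} {H : Tournament W} [Finite W]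
    (e : V ≃ W) (he : ∀ x y, H.Adj (e x) (e y) ↔ G.Adj x y) (D : G.Diamond) :
    D.chromaticNumber ≤ (D.map e he).chromaticNumber :=
  min_le_min (chi_le_of_hom e (fun x y => (he x y).2) fun _ hx => Set.mem_image_of_mem e hx)
    (chi_le_of_hom e (fun x y => (he x y).2) fun _ hx => Set.mem_image_of_mem e hx)

/-- A subtournament of an induced subtournament is isomorphic to an induced subtournament. -/
lemma exists_induce_of_induce_induce {G : Tournament V} [Finite V] {X : Set V} (Y : Set X)
    {c : ℕ} (hY : ∀ D : ((G.induce X).induce Y).Diamond, D.chromaticNumber < c) :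
    ∃ Z : Set V, ((G.induce X).induce Y).chromaticNumber ≤ (G.induce Z).chromaticNumber ∧
      ∀ D : (G.induce Z).Diamond, D.chromaticNumber < c := by
  let e := (Equiv.Set.image Subtype.val Y Subtype.val_injective).symm
  have he : ∀ x y, ((G.induce X).induce Y).Adj (e x) (e y) ↔
      (G.induce (Subtype.val '' Y)).Adj x y := fun x y => by
    obtain ⟨x', rfl⟩ := (Equiv.Set.image Subtype.val Y Subtype.val_injective).surjective x
    obtain ⟨y', rfl⟩ := (Equiv.Set.image Subtype.val Y Subtype.val_injective).surjective y
    simp only [e, Equiv.symm_apply_apply]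
    rfl
  refine ⟨Subtype.val '' Y, ?_, fun D => (D.chromaticNumber_le_map e he).trans_lt (hY _)⟩
  exact chi_le_of_hom (G := G) (H := G.induce X) Subtype.val (fun _ _ h => h)
    fun _ hx => Set.mem_image_of_mem _ hx

lemma diamondDichotomy_succ {n : ℕ} {c d : ℕ → ℕ} (h : DiamondDichotomy.{u} (n + 2) c d)
    (x : ℕ) :
    ∃ y, DiamondDichotomy.{u} (n + 3) (Function.update c (n + 3) y)
      (Function.update d (n + 2) x) := by
  obtain ⟨y, hy⟩ := exists_diamond_bound.{u} (S (n + 2)) x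
  refine ⟨y, fun V _ G hfree => ?_⟩
  by_contra! hcon
  obtain ⟨⟨D, hD⟩, hcon⟩ := hcon
  rw [Function.update_self] at hD
  refine absurd (hy V G hfree (fun X hX => ?_) D) (not_lt.2 hD)
  by_contra hXfree
  -- The first outcome for `G[X]` gives the new index `i = n + 2`, with `X` itself; the second keeps
  -- its old index, whose entries are not updated.
  rcases h X (G.induce X) hXfree with h' | ⟨i, hi, hit, Y, hY, hYD⟩
  · obtain ⟨D', hD'⟩ := hcon (n + 2) (by omega) (by omega) X
      (by rw [Function.update_self]; exact hX)
    rw [Function.update_of_ne (by omega)] at hD'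
    exact absurd (h' D') (not_lt.2 hD')
  · obtain ⟨Z, hZ, hZD⟩ := exists_induce_of_induce_induce Y hYD
    obtain ⟨D', hD'⟩ := hcon i hi (by omega) Z
      (by rw [Function.update_of_ne (by omega)]; exact hY.trans hZ)
    rw [Function.update_of_ne (by omega)] at hD'
    exact absurd (hZD D') (not_lt.2 hD')

end Tournament

/-- New quantifiers are innermost, so this carries the step, proved for all `c` and `d`, under the
existing prefix. -/
lemma AlternatingQuantifiers.mono {c₂ n : ℕ} {P P' : (ℕ → ℕ) → (ℕ → ℕ) → Prop}
    (hP : ∀ c d, P c d → P' c d) (h : AlternatingQuantifiers c₂ n P) :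
    AlternatingQuantifiers c₂ n P' := by
  induction n generalizing P P' with
  | zero => exact hP _ _ h
  | succ n ih => exact ih (fun c d hcd x => (hcd x).imp fun y => hP _ _) h

lemma alternatingQuantifiers_diamondDichotomy (n : ℕ) :
    AlternatingQuantifiers 1 n (Tournament.DiamondDichotomy.{u} (n + 2)) := by
  induction n with
  | zero => exact Tournament.diamondDichotomy_two (by simp)
  | succ n ih =>
    exact AlternatingQuantifiers.mono (n := n)
      (fun c d h x => Tournament.diamondDichotomy_succ h x) ih

theorem mainTheorem8 (t : ℕ) (ht : 2 ≤ t) :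
    AlternatingQuantifiers 1 (t - 2) fun c d =>
      ∀ (V : Type u) [Finite V] (G : Tournament V), G.IsFree (Tournament.S t) →
        (∀ D : G.Diamond, D.chromaticNumber < c t) ∨
        ∃ i : ℕ, 2 ≤ i ∧ i ≤ t - 1 ∧ ∃ X : Set V,
          d i ≤ (G.induce X).chromaticNumber ∧
          ∀ D : (G.induce X).Diamond, D.chromaticNumber < c i := by
  obtain ⟨n, rfl⟩ := Nat.exists_eq_add_of_le' ht
  exact alternatingQuantifiers_diamondDichotomy n
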